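/- Let $k$ be a field, let $H$ be a finite group acting by automorphisms on a group $\Gamma$, and let $k^H$ be the Hopf algebra of $k$-valued functions on $H$, with indicator functions $\delta_h$. The smash coproduct $k[\Gamma]\rtimes k^H$ is the Hopf algebra equal to $k[\Gamma]\otimes k^H$ as an algebra (write $r\#f=r\otimes f$), with $$\Delta(r\#\delta_h)=\sum_{l\in H} r\#\delta_{l^{-1}}\otimes l\cdot r\#\delta_{lh},\qquad \varepsilon(r\#\delta_h)=\delta_{h,1}.$$ A pair $(N,\Phi)$ is called a quotient datum (with first component $H$) if $N$ is a normal $H$-stable subgroup of $\Gamma$ and $\Phi:N\to (k^H)^\times$ is a group morphism such that $\Phi(r)(lh)=\Phi(l^{-1}\cdot r)(h)\,\Phi(r)(l)$ and $\Phi(r)=\Phi(srs^{-1})$ for all $r\in N$, $s\in\Gamma$, $h,l\in H$. Given a section $j:\Gamma/N\to\Gamma$ of the canonical projection with $j(1)=1$, the Hopf algebra $k[\Gamma/N]\rtimes_\Phi k^H$ is the vector space $k[\Gamma/N]\otimes k^H$ with unit $1\#1$, counit $\varepsilon(x\#\delta_h)=\delta_{h,1}$ and $$(x\#\delta_h)(y\#\delta_g)=xy\#\delta_h\delta_g\,\Phi\big(j(x)j(y)j(xy)^{-1}\big),\qquad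 \Delta(x\#\delta_h)=\sum_{l\in H}\big(x\#\delta_{l^{-1}}\big)\otimes \Big(l\cdot x\#\delta_{lh}\,\Phi\big(l\cdot j(x)\,j(l\cdot x)^{-1}\big)\Big).$$ Let $A$ be a Hopf algebra, $R$ a (unital associative) $k$-algebra and $\rho:A\to R$ an algebra map. A factorization of $\rho$ is a triple $(L,q,\varphi)$ with $L$ a Hopf algebra, $q:A\to L$ a surjective Hopf algebra map and $\varphi:L\to R$ an algebra map with $\varphi q=\rho$. The Hopf image of $\rho$ is the final factorization: a factorization $(A_\rho,p,\tilde\rho)$ such that for each factorization $(L,q,\varphi)$ there is a unique Hopf algebra map $f:L\to A_\rho$ with $fq=p$ and $\tilde\rho f=\varphi$. The map $\rho$ is inner faithful if $(A,\mathrm{id}_A,\rho)$ is its Hopf image. Corollary 4.3. Let $R$ be a $k$-algebra and let $\rho:k[\Gamma]\rtimes k^H\to R$ be an algebra map whose restriction to $k^H=1\#k^H$ is inner faithful. Then $$N=\{r\in\Gamma\mid \forall h\in H,\ \exists f\in (k^H)^\times \text{ with } \rho(h\cdot r\#1)=\rho(1\#f)\}$$ is an $H$-stable normal subgroup of $\Gamma$.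 Let $\Phi:N\to(k^H)^\times$ be any map such that $(N,\Phi)$ is a quotient datum and $\rho(r\#1)=\rho(1\#\Phi(r))$ for all $r\in N$ (that is, $(N,\Phi)\in\mathcal E(\rho)$). Then, for any choice of the section $j$, the Hopf image of $\rho$ is isomorphic to $k[\Gamma/N]\rtimes_\Phi k^H$. -/

import Mathlib

open scoped TensorProduct


universe w

noncomputable section

/-! ### The function Hopf algebra `k^H` of a finite group -/

/-- `k^H`, the `k`-valued functions on `H`. -/
def FunHopf (k H : Type*) : Type _ := H → k

namespace FunHopf

variable {k H : Type*} [Field k] [Group H]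

instance : CommRing (FunHopf k H) := inferInstanceAs (CommRing (H → k))

instance : Algebra k (FunHopf k H) := inferInstanceAs (Algebra k (H → k))

instance : CoeFun (FunHopf k H) (fun _ => H → k) := ⟨fun f => f⟩

/-- The value at `h` of an invertible function, as an invertible scalar. -/
def evalUnit (h : H) : (FunHopf k H)ˣ →* kˣ :=
  Units.map (Pi.evalMonoidHom (fun _ : H => k) h)

theorem evalUnit_val (h : H) (f : (FunHopf k H)ˣ) :
    ((evalUnit h f : kˣ) : k) = (f : FunHopf k H) h := rfl

variable [Fintype H] [DecidableEq H]

/-- The indicator function `δ_h`. -/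
def δ (h : H) : FunHopf k H := fun g => if h = g then 1 else 0

theorem δ_apply (h g : H) : (δ h : FunHopf k H) g = if h = g then 1 else 0 := rfl

/-- The basis of `k^H` formed by the indicator functions `δ_h`. -/
def basis : Module.Basis H k (FunHopf k H) :=
  Module.Basis.ofEquivFun
    { toFun := fun f h => f h
      invFun := fun f => f
      map_add' := fun _ _ => rfl
      map_smul' := fun _ _ => rfl
      left_inv := fun _ => rfl
      right_inv := fun _ => rfl }

theorem basis_apply (h : H) : (basis h : FunHopf k H) = δ h := by
  refine Module.Basis.apply_eq_iff.2 ?_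
  ext g
  change (δ h : FunHopf k H) g = _
  rw [δ_apply, Finsupp.single_apply]

/-- To compare two linear maps on `k^H` it is enough to compare them on indicator functions. -/
theorem hom_ext {M : Type*} [AddCommMonoid M] [Module k M] {f g : FunHopf k H →ₗ[k] M}
    (w : ∀ h, f (δ h) = g (δ h)) : f = g :=
  basis.ext fun h => by rw [basis_apply, w]

theorem δ_mul (g h : H) : (δ g * δ h : FunHopf k H) = if g = h then δ g else 0 := by
  funext x
  change (δ g : FunHopf k H) x * (δ h : FunHopf k H) x = _
  split_ifs with hgh
  · subst hgh
    simp [δ_apply]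
  · change _ = (0 : k)
    simp only [δ_apply]
    by_cases h1 : g = x
    · have h2 : h ≠ x := fun h => hgh (h1.trans h.symm)
      simp [h2]
    · simp [h1]

theorem eq_sum (f : FunHopf k H) : f = ∑ h : H, f h • (δ h : FunHopf k H) := by
  have := (Module.Basis.sum_repr (basis : Module.Basis H k (FunHopf k H)) f).symm
  simp only [basis_apply] at this
  exact this

theorem one_eq_sum : (1 : FunHopf k H) = ∑ h : H, δ h := by
  rw [eq_sum (1 : FunHopf k H)]
  exact Finset.sum_congr rfl fun h _ => one_smul k _

/-- `Δ(δ_h) = ∑_l δ_l ⊗ δ_{l⁻¹h}`, `ε(f) = f(1)`. -/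
instance : CoalgebraStruct k (FunHopf k H) where
  comul := basis.constr k fun h => ∑ l : H, δ l ⊗ₜ[k] δ (l⁻¹ * h)
  counit :=
    { toFun := fun f => f 1
      map_add' := fun _ _ => rfl
      map_smul' := fun _ _ => rfl }

theorem comul_δ (h : H) :
    Coalgebra.comul (R := k) (δ h : FunHopf k H) = ∑ l : H, δ l ⊗ₜ[k] δ (l⁻¹ * h) := by
  rw [← basis_apply]
  exact Module.Basis.constr_basis _ _ _ _

theorem counit_apply (f : FunHopf k H) : Coalgebra.counit (R := k) f = f 1 := rfl

theorem counit_δ (h : H) :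
    Coalgebra.counit (R := k) (δ h : FunHopf k H) = if h = 1 then 1 else 0 := δ_apply h 1

instance : Coalgebra k (FunHopf k H) where
  coassoc := by
    refine hom_ext fun h => ?_
    change (TensorProduct.assoc k _ _ _) (LinearMap.rTensor _ Coalgebra.comul
      (Coalgebra.comul (δ h))) = LinearMap.lTensor _ Coalgebra.comul (Coalgebra.comul (δ h))
    simp only [comul_δ, map_sum, LinearMap.rTensor_tmul, LinearMap.lTensor_tmul,
      TensorProduct.sum_tmul, TensorProduct.tmul_sum, TensorProduct.assoc_tmul]
    rw [Finset.sum_comm]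
    refine Finset.sum_congr rfl fun l _ => ?_
    refine Fintype.sum_equiv (Equiv.mulLeft l⁻¹) _ _ fun m => ?_
    simp [mul_assoc]
  rTensor_counit_comp_comul := by
    refine hom_ext fun h => ?_
    change LinearMap.rTensor _ Coalgebra.counit (Coalgebra.comul (δ h)) = 1 ⊗ₜ[k] δ h
    simp only [comul_δ, map_sum, LinearMap.rTensor_tmul, counit_δ]
    rw [Finset.sum_eq_single 1] <;> simp +contextual
  lTensor_counit_comp_comul := by
    refine hom_ext fun h => ?_
    change LinearMap.lTensor _ Coalgebra.counit (Coalgebra.comul (δ h)) = δ h ⊗ₜ[k] 1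
    simp only [comul_δ, map_sum, LinearMap.lTensor_tmul, counit_δ]
    rw [Finset.sum_eq_single h]
    · simp
    · intro l _ hl
      have : l⁻¹ * h ≠ 1 := fun e => hl (inv_mul_eq_one.mp e)
      simp [this]
    · simp

instance : Bialgebra k (FunHopf k H) :=
  Bialgebra.mk' k (FunHopf k H) rfl (fun {_ _} => rfl)
    (by
      rw [one_eq_sum, map_sum]
      simp only [comul_δ]
      rw [Algebra.TensorProduct.one_def, one_eq_sum]
      simp only [TensorProduct.sum_tmul, TensorProduct.tmul_sum]
      rw [Finset.sum_comm]
      conv_rhs => rw [Finset.sum_comm]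
      refine Finset.sum_congr rfl fun l _ => ?_
      exact Fintype.sum_equiv (Equiv.mulLeft l⁻¹) _ _ fun m => rfl)
    (by
      intro a b
      have key : (LinearMap.mul k (FunHopf k H)).compr₂ Coalgebra.comul =
          (LinearMap.mul k (FunHopf k H ⊗[k] FunHopf k H)).compl₁₂
            Coalgebra.comul Coalgebra.comul := by
        refine hom_ext fun g => hom_ext fun h => ?_
        simp only [LinearMap.compr₂_apply, LinearMap.compl₁₂_apply, LinearMap.mul_apply']
        rw [δ_mul]
        simp only [comul_δ, Finset.sum_mul_sum, Algebra.TensorProduct.tmul_mul_tmul, δ_mul]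
        split_ifs with hgh
        · subst hgh
          rw [comul_δ]
          refine Finset.sum_congr rfl fun l _ => ?_
          rw [Finset.sum_eq_single l]
          · simp
          · intro m _ hm
            simp [hm.symm]
          · simp
        · rw [map_zero]
          symm
          refine Finset.sum_eq_zero fun l _ => Finset.sum_eq_zero fun m _ => ?_
          split_ifs with h1 h2
          · subst h1
            exact absurd (mul_left_cancel h2) hgh
          all_goals simp
      exact congrArg (fun F => F a b) key)

/-- The antipode `S(f)(h) = f(h⁻¹)`. -/
def antipodeAux : FunHopf k H →ₗ[k] FunHopf k H where
  toFun := fun f h => f h⁻¹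
  map_add' := fun _ _ => rfl
  map_smul' := fun _ _ => rfl

theorem antipodeAux_δ (h : H) : antipodeAux (δ h : FunHopf k H) = δ h⁻¹ := by
  funext g
  change (δ h : FunHopf k H) g⁻¹ = _
  simp only [δ_apply, ← inv_eq_iff_eq_inv]

instance : HopfAlgebra k (FunHopf k H) where
  antipode := antipodeAux
  mul_antipode_rTensor_comul := by
    refine hom_ext fun h => ?_
    rw [LinearMap.comp_apply, LinearMap.comp_apply, LinearMap.comp_apply, comul_δ, counit_δ,
      Algebra.linearMap_apply]
    simp only [ map_sum, LinearMap.rTensor_tmul, LinearMap.mul'_apply, antipodeAux_δ, δ_mul]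
    rw [Finset.sum_congr rfl (g := fun l : H => if h = 1 then (δ l⁻¹ : FunHopf k H) else 0)]
    · split_ifs
      · rw [map_one, one_eq_sum]
        exact Fintype.sum_equiv (Equiv.inv H) _ _ fun m => rfl
      · simp
    · intro l _
      simp
  mul_antipode_lTensor_comul := by
    refine hom_ext fun h => ?_
    rw [LinearMap.comp_apply, LinearMap.comp_apply, LinearMap.comp_apply, comul_δ, counit_δ,
      Algebra.linearMap_apply]
    simp only [ map_sum, LinearMap.lTensor_tmul, LinearMap.mul'_apply, antipodeAux_δ, δ_mul]
    rw [Finset.sum_congr rfl (g := fun l : H => if h = 1 then (δ l : FunHopf k H) else 0)]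
    · split_ifs
      · rw [map_one, one_eq_sum]
      · simp
    · intro l _
      have : (l = (l⁻¹ * h)⁻¹) ↔ h = 1 := by
        rw [mul_inv_rev, inv_inv, eq_comm, mul_eq_right, inv_eq_one]
      simp only [this]

end FunHopf

/-! ### Hopf algebras `k[X] # k^H` with cocycles

Both the smash coproduct `k[Γ] ⋊ k^H` and the Hopf algebras `k[Γ/N] ⋊_Φ k^H` have a linear basis
`x # δ_h` with `x` in a group and `h ∈ H`, and structure maps of the same shape, given by scalars
`σ x y h` (for the multiplication) and `τ l x h` (for the comultiplication).  The Hopf algebra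
axioms are checked once, from the identities that these scalars satisfy; the two Hopf algebras are
then obtained by exhibiting the scalars. -/

/-- An action of `H` on the group `X` by automorphisms, with scalars `σ x y h` and `τ l x h`
satisfying the identities that make the formulas
`(x # δ_h)(y # δ_g) = σ x y h • xy # δ_h δ_g`,
`Δ(x # δ_h) = ∑_l τ l x h • (x # δ_{l⁻¹}) ⊗ (l.x # δ_{lh})`
into a Hopf algebra. -/
structure BismashData (k X H : Type*) [Field k] [Group X] [Group H] where
  act : H →* MulAut X
  σ : X → X → H → kˣ
  τ : H → X → H → kˣ
  σ_assoc : ∀ x y z h, σ x y h * σ (x * y) z h = σ y z h * σ x (y * z) h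
  σ_one_left : ∀ x h, σ 1 x h = 1
  σ_one_right : ∀ x h, σ x 1 h = 1
  σ_eval_one : ∀ x y, σ x y 1 = 1
  τ_coassoc : ∀ l m x h,
    τ l x h * τ m (act l x) (l * h) = τ (m * l) x h * τ l x (l⁻¹ * m⁻¹)
  τ_one_left : ∀ x h, τ 1 x h = 1
  τ_inv_left : ∀ x h, τ h⁻¹ x h = 1
  τ_one : ∀ l h, τ l 1 h = 1
  σ_τ : ∀ l x y h, σ x y h * τ l (x * y) h =
    τ l x h * τ l y h * (σ x y l⁻¹ * σ (act l x) (act l y) (l * h))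

/-- The vector space with basis `x # δ_h`, for `x ∈ X` and `h ∈ H`. -/
def Bismash {k X H : Type*} [Field k] [Group X] [Group H] (_ : BismashData k X H) : Type _ :=
  X × H →₀ k

namespace Bismash

variable {k X H : Type*} [Field k] [Group X] [Group H] {D : BismashData k X H}

instance : AddCommGroup (Bismash D) := inferInstanceAs (AddCommGroup (X × H →₀ k))

instance : Module k (Bismash D) := inferInstanceAs (Module k (X × H →₀ k))

/-- The basis `x # δ_h`. -/
def basis : Module.Basis (X × H) k (Bismash D) := Module.Basis.ofRepr (LinearEquiv.refl k _)

/-- The basis element `x # δ_h`. -/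
def b (x : X) (h : H) : Bismash D := basis (x, h)

theorem hom_ext {M : Type*} [AddCommMonoid M] [Module k M] {f g : Bismash D →ₗ[k] M}
    (w : ∀ x h, f (b x h) = g (b x h)) : f = g :=
  basis.ext fun p => w p.1 p.2

theorem induction {P : Bismash D → Prop} (p : Bismash D) (zero : P 0)
    (add : ∀ p q, P p → P q → P (p + q)) (smul : ∀ (c : k) p, P p → P (c • p))
    (base : ∀ x h, P (b x h)) : P p := by
  refine Submodule.span_induction (p := fun x _ => P x) (R := k) (s := Set.range basis) ?_ zero
    (fun x y _ _ => add x y) (fun c x _ => smul c x) (basis.mem_span p)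
  rintro _ ⟨⟨x, h⟩, rfl⟩
  exact base x h

/-- The linear map with prescribed values on the elements `x # δ_h`. -/
def lift {M : Type*} [AddCommMonoid M] [Module k M] (F : X → H → M) : Bismash D →ₗ[k] M :=
  basis.constr k fun p => F p.1 p.2

theorem lift_b {M : Type*} [AddCommMonoid M] [Module k M] (F : X → H → M) (x : X) (h : H) :
    lift F (b x h : Bismash D) = F x h :=
  Module.Basis.constr_basis _ _ _ _

variable [Fintype H] [DecidableEq H]

/-- The multiplication `(x # δ_h)(y # δ_g) = σ x y h • xy # δ_h δ_g`. -/
def mulAux : Bismash D →ₗ[k] Bismash D →ₗ[k] Bismash D :=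
  lift fun x h => lift fun y g => if h = g then (D.σ x y h : k) • b (x * y) h else 0

theorem mulAux_b (x y : X) (h g : H) : mulAux (b x h : Bismash D) (b y g) =
    if h = g then (D.σ x y h : k) • b (x * y) h else 0 := by
  rw [mulAux, lift_b, lift_b]

/-- The unit `1 # 1 = ∑_h 1 # δ_h`. -/
def oneAux : Bismash D := ∑ h : H, b 1 h

theorem mulAux_assoc (p q r : Bismash D) : mulAux (mulAux p q) r = mulAux p (mulAux q r) := by
  induction p using induction with
  | zero => simp
  | add p p' hp hp' => simp [hp, hp']
  | smul c p hp => simp [hp]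
  | base x h =>
  induction q using induction with
  | zero => simp
  | add q q' hq hq' => simp [hq, hq']
  | smul c q hq => simp [hq]
  | base y g =>
  induction r using induction with
  | zero => simp
  | add r r' hr hr' => simp [hr, hr']
  | smul c r hr => simp [hr]
  | base z f =>
  rw [mulAux_b, mulAux_b]
  split_ifs with h1 h2 h2
  · subst h1 h2
    rw [map_smul, map_smul, LinearMap.smul_apply, mulAux_b, mulAux_b, if_pos rfl, if_pos rfl,
      smul_smul, smul_smul, mul_assoc x y z, ← Units.val_mul, ← Units.val_mul, D.σ_assoc]
  · subst h1
    rw [map_smul, LinearMap.smul_apply, mulAux_b, if_neg h2]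
    simp
  · subst h2
    rw [map_smul, mulAux_b, if_neg h1]
    simp
  · simp

theorem one_mulAux (p : Bismash D) : mulAux oneAux p = p := by
  have : mulAux (D := D) oneAux = LinearMap.id := by
    refine hom_ext fun x h => ?_
    rw [oneAux, map_sum, LinearMap.sum_apply, Finset.sum_eq_single h]
    · simp [mulAux_b, D.σ_one_left]
    · intro g _ hg
      simp [mulAux_b, hg]
    · simp
  rw [this, LinearMap.id_apply]

theorem mulAux_one (p : Bismash D) : mulAux p oneAux = p := by
  have : (mulAux (D := D)).flip oneAux = LinearMap.id := by
    refine hom_ext fun x h => ?_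
    rw [LinearMap.flip_apply, oneAux, map_sum, Finset.sum_eq_single h]
    · simp [mulAux_b, D.σ_one_right]
    · intro g _ hg
      simp [mulAux_b, hg.symm]
    · simp
  rw [← LinearMap.flip_apply, this, LinearMap.id_apply]

instance : Ring (Bismash D) :=
  { (inferInstance : AddCommGroup (Bismash D)) with
    mul := fun p q => mulAux p q
    one := oneAux
    left_distrib := fun p q r => map_add (mulAux p) q r
    right_distrib := fun p q r => LinearMap.map_add₂ mulAux p q r
    zero_mul := fun p => LinearMap.map_zero₂ mulAux p
    mul_zero := fun p => map_zero (mulAux p)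
    mul_assoc := mulAux_assoc
    one_mul := one_mulAux
    mul_one := mulAux_one }

instance : Algebra k (Bismash D) :=
  Algebra.ofModule (fun c p q => LinearMap.map_smul₂ mulAux c p q)
    (fun c p q => map_smul (mulAux p) c q)

theorem b_mul_b (x y : X) (h g : H) : (b x h * b y g : Bismash D) =
    if h = g then (D.σ x y h : k) • b (x * y) h else 0 :=
  mulAux_b x y h g

theorem one_eq_sum : (1 : Bismash D) = ∑ h : H, b 1 h := rfl

/-- `Δ(x # δ_h) = ∑_l τ l x h • (x # δ_{l⁻¹}) ⊗ (l.x # δ_{lh})`, `ε(x # δ_h) = δ_{h,1}`. -/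
instance : CoalgebraStruct k (Bismash D) where
  comul := lift fun x h => ∑ l : H, (D.τ l x h : k) • (b x l⁻¹ ⊗ₜ[k] b (D.act l x) (l * h))
  counit := lift fun _ h => if h = 1 then 1 else 0

theorem comul_b (x : X) (h : H) : Coalgebra.comul (R := k) (b x h : Bismash D) =
    ∑ l : H, (D.τ l x h : k) • (b x l⁻¹ ⊗ₜ[k] b (D.act l x) (l * h)) :=
  lift_b _ _ _

theorem counit_b (x : X) (h : H) :
    Coalgebra.counit (R := k) (b x h : Bismash D) = if h = 1 then 1 else 0 :=
  lift_b _ _ _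

instance : Coalgebra k (Bismash D) where
  coassoc := by
    refine hom_ext fun x h => ?_
    rw [LinearMap.comp_apply, LinearMap.comp_apply, LinearMap.comp_apply, comul_b]
    simp only [map_sum, map_smul, LinearMap.rTensor_tmul, LinearMap.lTensor_tmul, comul_b,
      TensorProduct.sum_tmul, TensorProduct.tmul_sum, LinearEquiv.coe_coe,
      ← TensorProduct.smul_tmul', TensorProduct.tmul_smul, TensorProduct.assoc_tmul,
      Finset.smul_sum, smul_smul]
    rw [Finset.sum_comm]
    refine Finset.sum_congr rfl fun l _ => ?_
    refine Fintype.sum_equiv (Equiv.mulRight l⁻¹) _ _ fun n => ?_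
    simp only [Equiv.coe_mulRight]
    have e := D.τ_coassoc l (n * l⁻¹) x h
    simp only [mul_inv_rev, inv_inv, inv_mul_cancel_right, inv_mul_cancel_left] at e
    rw [← Units.val_mul, ← Units.val_mul, e, ← MulAut.mul_apply, ← map_mul]
    simp [mul_assoc]
  rTensor_counit_comp_comul := by
    refine hom_ext fun x h => ?_
    rw [LinearMap.comp_apply, comul_b]
    simp only [map_sum, map_smul, LinearMap.rTensor_tmul, counit_b]
    rw [Finset.sum_eq_single 1]
    · simp [D.τ_one_left]
    · intro l _ hl
      simp [hl]
    · simp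
  lTensor_counit_comp_comul := by
    refine hom_ext fun x h => ?_
    rw [LinearMap.comp_apply, comul_b]
    simp only [map_sum, map_smul, LinearMap.lTensor_tmul, counit_b]
    rw [Finset.sum_eq_single h⁻¹]
    · simp [D.τ_inv_left]
    · intro l _ hl
      have : l * h ≠ 1 := fun e => hl (eq_inv_of_mul_eq_one_left e)
      simp [this]
    · simp

theorem comul_mul_b (x y : X) (h g : H) :
    Coalgebra.comul (R := k) (b x h * b y g : Bismash D) =
      Coalgebra.comul (R := k) (b x h : Bismash D) * Coalgebra.comul (R := k) (b y g) := by
  rw [b_mul_b, comul_b, comul_b]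
  simp only [Finset.sum_mul_sum, smul_mul_smul_comm, Algebra.TensorProduct.tmul_mul_tmul, b_mul_b]
  split_ifs with hgh
  · subst hgh
    rw [map_smul, comul_b, Finset.smul_sum]
    refine Finset.sum_congr rfl fun l _ => ?_
    rw [Finset.sum_eq_single l]
    · rw [if_pos rfl, if_pos rfl, TensorProduct.smul_tmul_smul, smul_smul, smul_smul]
      simp only [← Units.val_mul, D.σ_τ, map_mul]
    · intro m _ hm
      simp [hm.symm]
    · simp
  · rw [map_zero]
    symm
    refine Finset.sum_eq_zero fun l _ => Finset.sum_eq_zero fun m _ => ?_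
    split_ifs with h1 h2
    · rw [inv_inj] at h1
      subst h1
      exact absurd (mul_left_cancel h2) hgh
    all_goals simp

instance : Bialgebra k (Bismash D) :=
  Bialgebra.mk' k (Bismash D)
    (by
      rw [one_eq_sum, map_sum, Finset.sum_eq_single 1]
      · simp [counit_b]
      · intro h _ hh
        simp [counit_b, hh]
      · simp)
    (by
      intro p q
      have key : (LinearMap.mul k (Bismash D)).compr₂ Coalgebra.counit =
          (LinearMap.mul k k).compl₁₂ Coalgebra.counit Coalgebra.counit := by
        refine hom_ext fun x h => hom_ext fun y g => ?_
        simp only [LinearMap.compr₂_apply, LinearMap.compl₁₂_apply, LinearMap.mul_apply']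
        rw [b_mul_b, counit_b, counit_b]
        by_cases hh : h = 1
        · subst hh
          by_cases hg : g = 1
          · subst hg
            simp [counit_b, D.σ_eval_one]
          · simp [hg, Ne.symm hg]
        · split_ifs <;> simp [counit_b, hh]
      exact congrArg (fun F => F p q) key)
    (by
      rw [one_eq_sum, map_sum]
      simp only [comul_b, D.τ_one, map_one, Units.val_one, one_smul]
      rw [Algebra.TensorProduct.one_def, one_eq_sum]
      simp only [TensorProduct.sum_tmul, TensorProduct.tmul_sum]
      rw [Finset.sum_comm]
      conv_rhs => rw [Finset.sum_comm]
      refine Fintype.sum_equiv (Equiv.inv H) _ _ fun l => ?_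
      exact Fintype.sum_equiv (Equiv.mulLeft l) _ _ fun m => rfl)
    (by
      intro p q
      have key : (LinearMap.mul k (Bismash D)).compr₂ Coalgebra.comul =
          (LinearMap.mul k (Bismash D ⊗[k] Bismash D)).compl₁₂
            Coalgebra.comul Coalgebra.comul := by
        refine hom_ext fun x h => hom_ext fun y g => ?_
        simp only [LinearMap.compr₂_apply, LinearMap.compl₁₂_apply, LinearMap.mul_apply']
        exact comul_mul_b x y h g
      exact congrArg (fun F => F p q) key)

/-- The antipode: `S(x # δ_h)` is a scalar multiple of `h⁻¹.x⁻¹ # δ_{h⁻¹}`. -/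
def antipodeAux : Bismash D →ₗ[k] Bismash D :=
  lift fun x h =>
    (((D.τ h⁻¹ x 1 * D.σ (D.act h⁻¹ x⁻¹) (D.act h⁻¹ x) h⁻¹)⁻¹ : kˣ) : k) •
      b (D.act h⁻¹ x⁻¹) h⁻¹

theorem antipodeAux_b (x : X) (h : H) : antipodeAux (b x h : Bismash D) =
    (((D.τ h⁻¹ x 1 * D.σ (D.act h⁻¹ x⁻¹) (D.act h⁻¹ x) h⁻¹)⁻¹ : kˣ) : k) •
      b (D.act h⁻¹ x⁻¹) h⁻¹ :=
  lift_b _ _ _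

theorem σ_inv_comm (D : BismashData k X H) (x : X) (h : H) : D.σ x⁻¹ x h = D.σ x x⁻¹ h := by
  have := D.σ_assoc x x⁻¹ x h
  rw [mul_inv_cancel, inv_mul_cancel, D.σ_one_left, D.σ_one_right, mul_one, mul_one] at this
  exact this.symm

theorem τ_act_one (D : BismashData k X H) (l : H) (x : X) :
    D.τ l⁻¹ (D.act l x) 1 = D.τ l x 1 := by
  have := D.τ_coassoc l l⁻¹ x l⁻¹
  rw [mul_inv_cancel, inv_mul_cancel, inv_inv, inv_mul_cancel, D.τ_one_left, one_mul] at this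
  have e := D.τ_inv_left x l⁻¹
  rw [inv_inv] at e
  rwa [e, one_mul] at this

instance : HopfAlgebra k (Bismash D) where
  antipode := antipodeAux
  mul_antipode_rTensor_comul := by
    refine hom_ext fun x h => ?_
    rw [LinearMap.comp_apply, LinearMap.comp_apply, LinearMap.comp_apply, comul_b, counit_b,
      Algebra.linearMap_apply]
    simp only [map_sum, map_smul, LinearMap.rTensor_tmul, LinearMap.mul'_apply, antipodeAux_b,
      inv_inv, smul_mul_assoc, b_mul_b, ← map_mul, inv_mul_cancel, map_one]
    split_ifs with hh
    · subst hh
      rw [map_one, one_eq_sum]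
      refine Finset.sum_congr rfl fun l _ => ?_
      rw [if_pos (mul_one l).symm, smul_smul, smul_smul, ← Units.val_mul, ← Units.val_mul]
      simp
    · rw [map_zero]
      refine Finset.sum_eq_zero fun l _ => ?_
      rw [if_neg (fun e => hh (mul_eq_left.mp e.symm)), smul_zero, smul_zero]
  mul_antipode_lTensor_comul := by
    refine hom_ext fun x h => ?_
    rw [LinearMap.comp_apply, LinearMap.comp_apply, LinearMap.comp_apply, comul_b, counit_b,
      Algebra.linearMap_apply]
    simp only [map_sum, map_smul, LinearMap.lTensor_tmul, LinearMap.mul'_apply, antipodeAux_b,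
      mul_smul_comm, b_mul_b]
    split_ifs with hh
    · subst hh
      rw [map_one, one_eq_sum]
      refine Fintype.sum_equiv (Equiv.inv H) _ _ fun l => ?_
      have e1 : D.act l⁻¹ (D.act l x) = x := by
        rw [← MulAut.mul_apply, ← map_mul, inv_mul_cancel, map_one, MulAut.one_apply]
      have e2 : D.act l⁻¹ (D.act l x)⁻¹ = x⁻¹ := by rw [map_inv, e1]
      simp only [mul_one, e1, e2, τ_act_one, σ_inv_comm, mul_inv_cancel, Equiv.inv_apply]
      rw [if_pos trivial, smul_smul, smul_smul, ← Units.val_mul, ← Units.val_mul]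
      simp
    · rw [map_zero]
      refine Finset.sum_eq_zero fun l _ => ?_
      have : ¬ l⁻¹ = (l * h)⁻¹ := fun e => hh (mul_eq_left.mp (inv_injective e).symm)
      rw [if_neg this, smul_zero, smul_zero]

theorem antipode_b (x : X) (h : H) : HopfAlgebra.antipode k (b x h : Bismash D) =
    (((D.τ h⁻¹ x 1 * D.σ (D.act h⁻¹ x⁻¹) (D.act h⁻¹ x) h⁻¹)⁻¹ : kˣ) : k) •
      b (D.act h⁻¹ x⁻¹) h⁻¹ :=
  antipodeAux_b x h

end Bismash

/-! ### The smash coproduct `k[Γ] ⋊ k^H` -/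

section Smash

variable (k Γ H : Type*) [Field k] [Group Γ] [Group H] [MulDistribMulAction H Γ]

/-- The smash coproduct data: all scalars are trivial. -/
def smashData : BismashData k Γ H where
  act := MulDistribMulAction.toMulAut H Γ
  σ := fun _ _ _ => 1
  τ := fun _ _ _ => 1
  σ_assoc := fun _ _ _ _ => rfl
  σ_one_left := fun _ _ => rfl
  σ_one_right := fun _ _ => rfl
  σ_eval_one := fun _ _ => rfl
  τ_coassoc := fun _ _ _ _ => rfl
  τ_one_left := fun _ _ => rfl
  τ_inv_left := fun _ _ => rfl
  τ_one := fun _ _ => rfl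
  σ_τ := fun _ _ _ _ => by simp

/-- The smash coproduct Hopf algebra `k[Γ] ⋊ k^H`, with basis `r # δ_h = Bismash.b r h`. -/
abbrev SmashCoproduct : Type _ := Bismash (smashData k Γ H)

end Smash

namespace SmashCoproduct

variable {k Γ H : Type*} [Field k] [Group Γ] [Group H] [MulDistribMulAction H Γ]
  [Fintype H] [DecidableEq H]

/-- As an algebra, `k[Γ] ⋊ k^H` is `k[Γ] ⊗ k^H`. -/
theorem b_mul_b (r s : Γ) (h g : H) : (Bismash.b r h * Bismash.b s g : SmashCoproduct k Γ H) =
    if h = g then Bismash.b (r * s) h else 0 := by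
  rw [Bismash.b_mul_b]
  exact if_congr Iff.rfl (one_smul k _) rfl

theorem comul_b (r : Γ) (h : H) :
    Coalgebra.comul (R := k) (Bismash.b r h : SmashCoproduct k Γ H) =
      ∑ l : H, Bismash.b r l⁻¹ ⊗ₜ[k] Bismash.b (l • r) (l * h) := by
  rw [Bismash.comul_b]
  exact Finset.sum_congr rfl fun l _ => one_smul k _

theorem antipode_b (r : Γ) (h : H) :
    HopfAlgebra.antipode k (Bismash.b r h : SmashCoproduct k Γ H) =
      Bismash.b (h⁻¹ • r⁻¹) h⁻¹ := by
  rw [Bismash.antipode_b]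
  have e : ((1 * 1 : kˣ)⁻¹ : kˣ) = 1 := by simp
  change (((1 * 1 : kˣ)⁻¹ : kˣ) : k) • _ = _
  rw [e]
  exact one_smul k _

/-- The element `r # f = ∑_h f(h) r # δ_h`. -/
def elt (r : Γ) (f : FunHopf k H) : SmashCoproduct k Γ H := ∑ h : H, f h • Bismash.b r h

theorem elt_mul_elt (r s : Γ) (f g : FunHopf k H) :
    (elt r f * elt s g : SmashCoproduct k Γ H) = elt (r * s) (f * g) := by
  unfold elt
  rw [Finset.sum_mul_sum]
  refine Finset.sum_congr rfl fun h _ => ?_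
  rw [Finset.sum_eq_single h]
  · rw [smul_mul_smul_comm, b_mul_b, if_pos rfl]
    rfl
  · intro g' _ hg
    rw [smul_mul_smul_comm, b_mul_b, if_neg hg.symm, smul_zero]
  · simp

theorem elt_one_one : (elt 1 1 : SmashCoproduct k Γ H) = 1 := by
  rw [Bismash.one_eq_sum]
  exact Finset.sum_congr rfl fun h _ => one_smul k _

/-- The inclusion `k^H → k[Γ] ⋊ k^H`, `f ↦ 1 # f`. -/
def incl (k Γ H : Type*) [Field k] [Group Γ] [Group H] [MulDistribMulAction H Γ]
    [Fintype H] [DecidableEq H] : FunHopf k H →ₐ[k] SmashCoproduct k Γ H :=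
  AlgHom.ofLinearMap
    { toFun := fun f => elt 1 f
      map_add' := fun f g => by
        unfold elt
        rw [← Finset.sum_add_distrib]
        exact Finset.sum_congr rfl fun h _ => add_smul _ _ _
      map_smul' := fun c f => by
        unfold elt
        rw [Finset.smul_sum]
        exact Finset.sum_congr rfl fun h _ => mul_smul _ _ _ }
    elt_one_one
    (fun f g => by
      change elt 1 (f * g) = (elt 1 f * elt 1 g : SmashCoproduct k Γ H)
      rw [elt_mul_elt, mul_one])

end SmashCoproduct

/-! ### Quotient data and the Hopf algebras `k[Γ/N] ⋊_Φ k^H` -/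

/-- A quotient datum `(N, Φ) = (H, N, Φ)` for `H ↷ Γ` whose first component is the whole
group `H`: a normal `H`-stable subgroup `N` of `Γ` with a group morphism `Φ : N → (k^H)ˣ` such that
`Φ(r)(lh) = Φ(l⁻¹.r)(h) Φ(r)(l)` and `Φ(r) = Φ(s r s⁻¹)`. -/
structure QuotientDatum (k Γ H : Type*) [Field k] [Group Γ] [Group H]
    [MulDistribMulAction H Γ] where
  N : Subgroup Γ
  normal : N.Normal
  stable : ∀ (h : H), ∀ r ∈ N, h • r ∈ N
  Φ : N →* (FunHopf k H)ˣ
  Φ_mul : ∀ (r : N) (l h : H), (Φ r : FunHopf k H) (l * h) =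
    (Φ ⟨l⁻¹ • (r : Γ), stable l⁻¹ r r.2⟩ : FunHopf k H) h * (Φ r : FunHopf k H) l
  Φ_conj : ∀ (r : N) (s : Γ), Φ r = Φ ⟨s * r * s⁻¹, normal.conj_mem r r.2 s⟩

/-- A section `j : Γ/N → Γ` of the canonical projection with `j(1) = 1`. -/
structure NormalizedSection {Γ : Type*} [Group Γ] (N : Subgroup Γ) where
  toFun : Γ ⧸ N → Γ
  mk_toFun : ∀ x, (toFun x : Γ ⧸ N) = x
  map_one : toFun ((1 : Γ) : Γ ⧸ N) = 1

instance {Γ : Type*} [Group Γ] (N : Subgroup Γ) : CoeFun (NormalizedSection N)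
    (fun _ => Γ ⧸ N → Γ) := ⟨NormalizedSection.toFun⟩

instance {Γ : Type*} [Group Γ] (N : Subgroup Γ) : Nonempty (NormalizedSection N) := by
  classical
  refine ⟨⟨fun x => if x = ((1 : Γ) : Γ ⧸ N) then 1 else x.out, fun x => ?_, if_pos rfl⟩⟩
  split_ifs with h
  · exact h.symm
  · exact Quotient.out_eq' x

namespace QuotientDatum

variable {k Γ H : Type*} [Field k] [Group Γ] [Group H] [MulDistribMulAction H Γ]
  (D : QuotientDatum k Γ H)

instance : D.N.Normal := D.normal

/-- The action of `H` on `Γ/N`: `l.u(r) = u(l.r)`. -/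
def act : H →* MulAut (Γ ⧸ D.N) where
  toFun l := MonoidHom.toMulEquiv
    (QuotientGroup.map D.N D.N (MulDistribMulAction.toMonoidHom Γ l) (D.stable l))
    (QuotientGroup.map D.N D.N (MulDistribMulAction.toMonoidHom Γ l⁻¹) (D.stable l⁻¹))
    (by
      ext r
      change ((l⁻¹ • l • r : Γ) : Γ ⧸ D.N) = r
      rw [inv_smul_smul])
    (by
      ext r
      change ((l • l⁻¹ • r : Γ) : Γ ⧸ D.N) = r
      rw [smul_inv_smul])
  map_one' := by
    ext x
    induction x using QuotientGroup.induction_on with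
    | H r =>
      change (((1 : H) • r : Γ) : Γ ⧸ D.N) = r
      rw [one_smul]
  map_mul' l m := by
    ext x
    induction x using QuotientGroup.induction_on with
    | H r =>
      change (((l * m) • r : Γ) : Γ ⧸ D.N) = ((l • m • r : Γ) : Γ ⧸ D.N)
      rw [mul_smul]

theorem act_mk (l : H) (r : Γ) : D.act l (r : Γ ⧸ D.N) = ((l • r : Γ) : Γ ⧸ D.N) := rfl

/-- The scalar `Φ(n)(h)`, for `n ∈ N`. -/
def φ (h : H) (n : Γ) (hn : n ∈ D.N) : kˣ := FunHopf.evalUnit h (D.Φ ⟨n, hn⟩)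

theorem φ_congr {h : H} {n m : Γ} (hn : n ∈ D.N) (e : n = m) :
    D.φ h n hn = D.φ h m (e ▸ hn) := by
  subst e; rfl

theorem φ_mul_φ {h : H} {n m : Γ} (hn : n ∈ D.N) (hm : m ∈ D.N) :
    D.φ h n hn * D.φ h m hm = D.φ h (n * m) (mul_mem hn hm) := by
  unfold φ
  rw [← map_mul, ← map_mul]
  rfl

theorem φ_conj {h : H} {n : Γ} (hn : n ∈ D.N) (s : Γ) :
    D.φ h n hn = D.φ h (s * n * s⁻¹) (D.normal.conj_mem n hn s) := by
  unfold φ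
  rw [D.Φ_conj ⟨n, hn⟩ s]

theorem φ_smul {l h : H} {n : Γ} (hn : n ∈ D.N) :
    D.φ (l * h) n hn = D.φ h (l⁻¹ • n) (D.stable l⁻¹ n hn) * D.φ l n hn :=
  Units.ext (D.Φ_mul ⟨n, hn⟩ l h)

theorem φ_eq_smul (m : H) {h : H} {n : Γ} (hn : n ∈ D.N) :
    D.φ h n hn = D.φ (m * h) (m • n) (D.stable m n hn) * D.φ m⁻¹ n hn := by
  have e := D.φ_smul (l := m⁻¹) (h := m * h) hn
  rw [D.φ_congr (D.stable m⁻¹⁻¹ n hn) (by rw [inv_inv] : m⁻¹⁻¹ • n = m • n)] at e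
  rw [← e]
  congr 1
  group

theorem φ_one {h : H} (h1 : (1 : Γ) ∈ D.N) : D.φ h 1 h1 = 1 := by
  have := D.φ_mul_φ (h := h) h1 h1
  rw [D.φ_congr (mul_mem h1 h1) (mul_one 1)] at this
  exact mul_eq_left.mp this

theorem φ_eval_one {n : Γ} (hn : n ∈ D.N) : D.φ 1 n hn = 1 := by
  have := D.φ_smul (l := 1) (h := 1) hn
  rw [D.φ_congr (D.stable 1⁻¹ n hn) (by simp : (1 : H)⁻¹ • n = n)] at this
  rw [mul_one] at this
  exact mul_eq_left.mp this.symm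

variable (j : NormalizedSection D.N)

theorem σ_mem (x y : Γ ⧸ D.N) : j x * j y * (j (x * y))⁻¹ ∈ D.N := by
  rw [← QuotientGroup.eq_one_iff]
  simp [j.mk_toFun]

theorem τ_mem (l : H) (x : Γ ⧸ D.N) : l • j x * (j (D.act l x))⁻¹ ∈ D.N := by
  rw [← QuotientGroup.eq_one_iff, QuotientGroup.mk_mul, ← D.act_mk]
  simp [j.mk_toFun]

/-- The scalars `σ x y h = Φ(j(x) j(y) j(xy)⁻¹)(h)` and `τ l x h = Φ(l.j(x) j(l.x)⁻¹)(lh)`. -/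
def bismashData : BismashData k (Γ ⧸ D.N) H where
  act := D.act
  σ := fun x y h => D.φ h (j x * j y * (j (x * y))⁻¹) (D.σ_mem j x y)
  τ := fun l x h => D.φ (l * h) (l • j x * (j (D.act l x))⁻¹) (D.τ_mem j l x)
  σ_assoc := fun x y z h => by
    rw [D.φ_conj (D.σ_mem j y z) (j x), φ_mul_φ, φ_mul_φ]
    apply φ_congr
    rw [mul_assoc x y z]
    group
  σ_one_left := fun x h => by
    rw [D.φ_congr _ (m := 1), φ_one]
    have : j (1 : Γ ⧸ D.N) = 1 := j.map_one
    simp [this]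
  σ_one_right := fun x h => by
    rw [D.φ_congr _ (m := 1), φ_one]
    have : j (1 : Γ ⧸ D.N) = 1 := j.map_one
    simp [this]
  σ_eval_one := fun x y => D.φ_eval_one _
  τ_coassoc := fun l m x h => by
    rw [D.φ_eq_smul m (D.τ_mem j l x), mul_right_comm, φ_mul_φ, mul_assoc m l h,
      mul_inv_cancel_left]
    congr 1
    apply φ_congr
    rw [map_mul, MulAut.mul_apply, smul_mul', smul_inv', mul_smul]
    group
  τ_one_left := fun x h => by
    rw [D.φ_congr _ (m := 1), φ_one]
    simp
  τ_inv_left := fun x h => by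
    simp only [inv_mul_cancel]
    exact D.φ_eval_one _
  τ_one := fun l h => by
    rw [D.φ_congr _ (m := 1), φ_one]
    have : j (1 : Γ ⧸ D.N) = 1 := j.map_one
    simp [this]
  σ_τ := fun l x y h => by
    rw [D.φ_eq_smul l (D.σ_mem j x y), mul_right_comm, φ_mul_φ,
      D.φ_conj (D.τ_mem j l y) (j (D.act l x)), φ_mul_φ,
      mul_comm (D.φ l⁻¹ _ _) (D.φ (l * h) _ _), ← mul_assoc (D.φ _ _ _),
      φ_mul_φ]
    congr 1
    apply φ_congr
    simp only [smul_mul', smul_inv', map_mul]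
    group

/-- The Hopf algebra `k[Γ/N] ⋊_Φ k^H` of a quotient datum, built with the section `j`.  On the basis
`x # δ_h` (`x ∈ Γ/N`, `h ∈ H`) its structure maps are
`(x # δ_h)(y # δ_g) = xy # δ_h δ_g Φ(j(x) j(y) j(xy)⁻¹)` and
`Δ(x # δ_h) = ∑_l (x # δ_{l⁻¹}) ⊗ (l.x # δ_{lh} Φ(l.j(x) j(l.x)⁻¹))`,
with unit `∑_h 1 # δ_h` and counit `ε(x # δ_h) = δ_{h,1}`. -/
abbrev TwistedSmash : Type _ := Bismash (D.bismashData j)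

variable [Fintype H] [DecidableEq H]

theorem b_mul_b (x y : Γ ⧸ D.N) (h g : H) :
    (Bismash.b x h * Bismash.b y g : D.TwistedSmash j) =
      if h = g then (D.Φ ⟨j x * j y * (j (x * y))⁻¹, D.σ_mem j x y⟩ : FunHopf k H) h •
        Bismash.b (x * y) h else 0 :=
  Bismash.b_mul_b x y h g

theorem comul_b (x : Γ ⧸ D.N) (h : H) :
    Coalgebra.comul (R := k) (Bismash.b x h : D.TwistedSmash j) =
      ∑ l : H, (D.Φ ⟨l • j x * (j (D.act l x))⁻¹, D.τ_mem j l x⟩ : FunHopf k H) (l * h) •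
        (Bismash.b x l⁻¹ ⊗ₜ[k] Bismash.b (D.act l x) (l * h)) :=
  Bismash.comul_b x h

end QuotientDatum

/-! ### Hopf images -/

section HopfImage

variable {k A L R : Type*} [Field k] [Ring A] [HopfAlgebra k A] [Ring L] [HopfAlgebra k L]
  [Ring R] [Algebra k R]

/-- `(L, q, φ)` is a factorization of the algebra map `ρ : A → R`: `q : A → L` is a surjective map
of Hopf algebras and `φ : L → R` an algebra map with `φ q = ρ`.  (A bialgebra map between Hopf
algebras commutes with the antipodes.) -/
structure IsHopfFactorization (ρ : A →ₐ[k] R) (q : A →ₐc[k] L) (φ : L →ₐ[k] R) : Prop where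
  surjective : Function.Surjective q
  comp_eq : φ.comp (q : A →ₐ[k] L) = ρ

/-- `(L, p, ρ')` is the Hopf image of `ρ`: it is a final object among the factorizations
`(L', q, φ)` of `ρ`, where `L'` ranges over the Hopf algebras in `Type w`. -/
def IsHopfImage (ρ : A →ₐ[k] R) (p : A →ₐc[k] L) (ρ' : L →ₐ[k] R) : Prop :=
  IsHopfFactorization ρ p ρ' ∧
    ∀ (L' : Type w) [Ring L'] [HopfAlgebra k L'] (q : A →ₐc[k] L') (φ : L' →ₐ[k] R),
      IsHopfFactorization ρ q φ →
        ∃! f : L' →ₐc[k] L, f.comp q = p ∧ ρ'.comp (f : L' →ₐ[k] L) = φ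

/-- `ρ` is inner faithful: `(A, id, ρ)` is the Hopf image of `ρ`.  (Every Hopf algebra quotient of
`A` is isomorphic to one in the universe of `A`.) -/
def InnerFaithful {k : Type*} {A : Type w} {R : Type*} [Field k] [Ring A] [HopfAlgebra k A]
    [Ring R] [Algebra k R] (ρ : A →ₐ[k] R) : Prop :=
  IsHopfImage.{w} ρ (BialgHom.id k A) ρ

end HopfImage

section Representation

variable {k Γ H R : Type*} [Field k] [Group Γ] [Group H] [MulDistribMulAction H Γ]
  [Fintype H] [DecidableEq H] [Ring R] [Algebra k R]

open SmashCoproduct in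
/-- The set `𝓔(ρ)` of quotient data `(N, Φ)` with `ρ(r # 1) = ρ(1 # Φ(r))` for all `r ∈ N`. -/
def compatibleData (ρ : SmashCoproduct k Γ H →ₐ[k] R) : Set (QuotientDatum k Γ H) :=
  {D | ∀ r : D.N, ρ (elt (r : Γ) 1) = ρ (elt 1 (D.Φ r : FunHopf k H))}

open SmashCoproduct in
/-- The subgroup of those `r ∈ Γ` such that for all `h ∈ H` there is an invertible `f ∈ k^H` with
`ρ(h.r # 1) = ρ(1 # f)`. -/
def imageSubgroup (ρ : SmashCoproduct k Γ H →ₐ[k] R) : Subgroup Γ where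
  carrier := {r | ∀ h : H, ∃ f : (FunHopf k H)ˣ,
    ρ (elt (h • r) 1) = ρ (elt 1 (f : FunHopf k H))}
  one_mem' := fun h => ⟨1, by rw [smul_one, Units.val_one]⟩
  mul_mem' := by
    intro r s hr hs h
    obtain ⟨f, hf⟩ := hr h
    obtain ⟨g, hg⟩ := hs h
    refine ⟨f * g, ?_⟩
    have e1 := elt_mul_elt (h • r) (h • s) (1 : FunHopf k H) 1
    have e2 := elt_mul_elt (1 : Γ) 1 (f : FunHopf k H) g
    rw [mul_one] at e1 e2
    rw [smul_mul', ← e1, Units.val_mul, ← e2, map_mul, map_mul, hf, hg]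
  inv_mem' := by
    intro r hr h
    obtain ⟨f, hf⟩ := hr h
    refine ⟨f⁻¹, ?_⟩
    have e1 := elt_mul_elt (h • r)⁻¹ (h • r) (1 : FunHopf k H) 1
    have e2 := elt_mul_elt (1 : Γ) 1 (f : FunHopf k H) (f⁻¹ : (FunHopf k H)ˣ)
    rw [inv_mul_cancel, mul_one, elt_one_one] at e1
    rw [Units.mul_inv, mul_one, elt_one_one] at e2
    have d1 := congrArg ρ e1
    have d2 := congrArg ρ e2
    rw [map_mul, map_one] at d1 d2
    rw [smul_inv']
    rw [hf] at d1
    exact left_inv_eq_right_inv d1 d2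

end Representation

end

/-!
Let `q : k[Γ] ⋊ k^H → L` be a surjection of Hopf algebras through which `ρ` factors. The `h` with
`ρ(1 # δ_h) ≠ 0` generate `H`, by inner faithfulness of the restriction of `ρ`, and the `h` with
`q(1 # δ_h) ≠ 0` form a submonoid, so `q` kills no `1 # δ_h`. Cutting `Δ(r # δ_{gh})` down by
`1 ⊗ (1 # δ_h)` leaves the single term `(r # δ_g) ⊗ (g⁻¹ · r # δ_h)`; with `h = 1` this makes the
elements `q(r # δ_g)` eigenvectors of one coaction, and those with `r` in distinct cosets of the
image subgroup `N_q` of `q` are linearly independent. The same identity propagates the scalars `Φ`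
from the support of `ρ` to all of `H`, so `q` is compatible with `(N_q, Φ|N_q)`, and its kernel is
that of the projection `k[Γ] ⋊ k^H → k[Γ/N_q] ⋊_Φ k^H`. As `N_q ≤ N`, this kernel is contained in
that of the projection onto `k[Γ/N] ⋊_Φ k^H`, which is therefore the final factorization.
-/

section LinearAlgebra

variable {k V W : Type*} [Field k] [AddCommGroup V] [Module k V] [AddCommGroup W] [Module k W]

theorem exists_eq_smul_of_tmul_eq_tmul {v v' : V} {w w' : W} (hw : w ≠ 0)
    (h : v ⊗ₜ[k] w = v' ⊗ₜ[k] w') : ∃ c : k, v = c • v' := by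
  obtain ⟨ω, hω⟩ := Module.Projective.exists_dual_eq_one k hw
  exact ⟨ω w', by simpa [hω] using congrArg (TensorProduct.rid k V ∘ ω.lTensor V) h⟩

theorem tmul_right_injective {v : V} (hv : v ≠ 0) :
    Function.Injective fun w : W => v ⊗ₜ[k] w := by
  obtain ⟨ω, hω⟩ := Module.Projective.exists_dual_eq_one k hv
  intro w w' h
  simpa [hω] using congrArg (TensorProduct.lid k W ∘ ω.rTensor W) h

theorem tmul_ne_zero {v : V} {w : W} (hv : v ≠ 0) (hw : w ≠ 0) : v ⊗ₜ[k] w ≠ 0 := fun h =>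
  hw (tmul_right_injective hv (h.trans (TensorProduct.tmul_zero W v).symm))

theorem eq_zero_of_sum_tmul_eq_zero {ι : Type*} [Fintype ι] {v : ι → V}
    (hv : LinearIndependent k v) {w : ι → W} (h : ∑ i, v i ⊗ₜ[k] w i = 0) (i : ι) : w i = 0 := by
  rw [← Module.forall_dual_apply_eq_zero_iff k]
  intro ω
  refine Fintype.linearIndependent_iff.1 hv (fun i => ω (w i)) ?_ i
  simpa using congrArg (TensorProduct.rid k V ∘ ω.lTensor V) h

/-- A joint version of the independence of eigenvectors, and of that of grouplike elements. -/
theorem linearIndependent_of_map_eq_tmul {ι : Type*} {v : ι → V} (hv : ∀ i, v i ≠ 0)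
    (hsep : Pairwise fun i j => ∃ (δ : V →ₗ[k] V ⊗[k] W) (w : ι → W),
      (∀ l, δ (v l) = v l ⊗ₜ[k] w l) ∧ w i ≠ w j) :
    LinearIndependent k v := by
  classical
  rw [← linearIndepOn_univ_iff, linearIndepOn_iff_linearIndepOn_finset]
  intro s _
  induction s using Finset.induction with
  | empty => simp
  | insert a s has ih =>
    have ih := ih (Set.subset_univ _)
    rw [Finset.coe_insert, linearIndepOn_insert (mod_cast has)]
    refine ⟨ih, fun hmem => ?_⟩
    obtain ⟨c, hc⟩ := (Submodule.mem_span_image_finset_iff_exists_fun k).1 hmem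
    have hc0 (x : s) : c x = 0 := by
      obtain ⟨δ, w, hδ, hne⟩ := hsep fun e : x = a => has (e ▸ x.2)
      have hsum : ∑ y : s, v y ⊗ₜ[k] (c y • (w y - w a)) = 0 := by
        have h := hδ a
        rw [← hc, map_sum, TensorProduct.sum_tmul, ← sub_eq_zero, ← Finset.sum_sub_distrib] at h
        simpa only [map_smul, hδ, ← TensorProduct.smul_tmul', ← TensorProduct.tmul_smul,
          ← TensorProduct.tmul_sub, ← smul_sub] using h
      exact (smul_eq_zero.1 (eq_zero_of_sum_tmul_eq_zero ih hsum x)).resolve_right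
        (sub_ne_zero.2 hne)
    refine hv a (hc.symm.trans (Finset.sum_eq_zero fun x _ => ?_))
    rw [hc0 x, zero_smul]

end LinearAlgebra

section Lift

variable {k A B R : Type*} [CommRing k] [Ring A] [Ring B] [Ring R]

theorem exists_algHom_comp_eq_of_surjective [Algebra k A] [Algebra k B] [Algebra k R]
    {q : A →ₐ[k] B} (hq : Function.Surjective q) {ψ : A →ₐ[k] R}
    (hker : ∀ a, q a = 0 → ψ a = 0) : ∃ f : B →ₐ[k] R, f.comp q = ψ := by
  let f := q.toRingHom.liftOfSurjective hq ⟨ψ.toRingHom, fun a ha => hker a ha⟩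
  have hf (a : A) : f (q a) = ψ a := RingHom.liftOfSurjective_comp_apply q.toRingHom hq _ a
  exact ⟨{ f with commutes' := fun c => by simpa using hf (algebraMap k A c) }, AlgHom.ext hf⟩

theorem exists_bialgHom_comp_eq_of_surjective {C : Type*} [Ring C] [Bialgebra k A] [Bialgebra k B]
    [Bialgebra k C] {q : A →ₐc[k] B} (hq : Function.Surjective q) {p : A →ₐc[k] C}
    (hker : ∀ a, q a = 0 → p a = 0) : ∃ f : B →ₐc[k] C, f.comp q = p := by
  obtain ⟨f, hf⟩ := exists_algHom_comp_eq_of_surjective (q := (q : A →ₐ[k] B)) hq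
    (ψ := (p : A →ₐ[k] C)) hker
  have hf' (a : A) : f (q a) = p a := DFunLike.congr_fun hf a
  refine ⟨BialgHom.ofAlgHom f ?_ ?_, BialgHom.ext hf'⟩
  · ext b
    obtain ⟨a, rfl⟩ := hq b
    simp [hf']
  · ext b
    obtain ⟨a, rfl⟩ := hq b
    have hcomp : f.toLinearMap ∘ₗ (q : A →ₗ[k] B) = (p : A →ₗ[k] C) := LinearMap.ext hf'
    change TensorProduct.map f.toLinearMap f.toLinearMap (Coalgebra.comul (R := k) (q a)) =
      Coalgebra.comul (R := k) (f (q a))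
    rw [hf', ← CoalgHomClass.map_comp_comul_apply q, ← CoalgHomClass.map_comp_comul_apply p,
      ← LinearMap.comp_apply, ← TensorProduct.map_comp]
    exact congrArg (fun F => TensorProduct.map F F _) hcomp

end Lift

section HopfImage

variable {k A L R : Type*} [Field k] [Ring A] [HopfAlgebra k A] [Ring L] [HopfAlgebra k L]
  [Ring R] [Algebra k R]

theorem exists_isHopfFactorization {ρ : A →ₐ[k] R} {q : A →ₐc[k] L} (hq : Function.Surjective q)
    (hker : ∀ a, q a = 0 → ρ a = 0) : ∃ φ : L →ₐ[k] R, IsHopfFactorization ρ q φ := by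
  obtain ⟨φ, hφ⟩ := exists_algHom_comp_eq_of_surjective (q := (q : A →ₐ[k] L)) hq hker
  exact ⟨φ, hq, hφ⟩

theorem IsHopfFactorization.isHopfImage_of_ker_le {ρ : A →ₐ[k] R} {p : A →ₐc[k] L}
    {ρ' : L →ₐ[k] R} (h : IsHopfFactorization ρ p ρ')
    (hker : ∀ (L' : Type w) [Ring L'] [HopfAlgebra k L'] (q : A →ₐc[k] L') (φ : L' →ₐ[k] R),
      IsHopfFactorization ρ q φ → ∀ a, q a = 0 → p a = 0) :
    IsHopfImage.{w} ρ p ρ' := by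
  refine ⟨h, fun L' _ _ q φ hφ => ?_⟩
  obtain ⟨f, hf⟩ := exists_bialgHom_comp_eq_of_surjective hφ.surjective (hker L' q φ hφ)
  have hf' (a : A) : f (q a) = p a := DFunLike.congr_fun hf a
  refine ⟨f, ⟨hf, ?_⟩, fun g hg => BialgHom.ext fun b => ?_⟩
  · ext b
    obtain ⟨a, rfl⟩ := hφ.surjective b
    calc ρ' (f (q a)) = ρ a := by rw [hf']; exact DFunLike.congr_fun h.comp_eq a
      _ = φ (q a) := (DFunLike.congr_fun hφ.comp_eq a).symm
  · obtain ⟨a, rfl⟩ := hφ.surjective b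
    exact (DFunLike.congr_fun hg.1 a).trans (hf' a).symm

theorem InnerFaithful.injective_of_ker_le {A L : Type w} [Ring A] [HopfAlgebra k A] [Ring L]
    [HopfAlgebra k L] {ρ : A →ₐ[k] R} (hρ : InnerFaithful ρ) {q : A →ₐc[k] L}
    (hq : Function.Surjective q) (hker : ∀ a, q a = 0 → ρ a = 0) : Function.Injective q := by
  obtain ⟨φ, hφ⟩ := exists_isHopfFactorization hq hker
  obtain ⟨f, ⟨hf, -⟩, -⟩ := hρ.2 L q φ hφ
  exact Function.LeftInverse.injective fun a => DFunLike.congr_fun hf a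

end HopfImage

namespace FunHopf

variable {k H : Type*} [Field k] [Group H] [DecidableEq H] (K : Subgroup H)

/-- The restriction of functions to a subgroup, as a map of algebras. -/
def restrictAlgHom : FunHopf k H →ₐ[k] FunHopf k K where
  toFun f := fun h : K => f h
  map_one' := rfl
  map_mul' _ _ := rfl
  map_zero' := rfl
  map_add' _ _ := rfl
  commutes' _ := rfl

theorem restrictAlgHom_δ [DecidableEq K] (h : K) :
    restrictAlgHom K (δ (h : H) : FunHopf k H) = δ h :=
  funext fun _ => if_congr Subtype.ext_iff.symm rfl rfl

theorem restrictAlgHom_δ_of_notMem {h : H} (hh : h ∉ K) :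
    restrictAlgHom K (δ h : FunHopf k H) = 0 :=
  funext fun g => if_neg fun e : h = g => hh (e ▸ g.2)

variable [Fintype H]

theorem comul_eq_sum (f : FunHopf k H) :
    Coalgebra.comul (R := k) f = ∑ p : H × H, f (p.1 * p.2) • (δ p.1 ⊗ₜ[k] δ p.2) := by
  conv_lhs => rw [eq_sum f]
  simp only [map_sum, map_smul, comul_δ, Finset.smul_sum]
  rw [Finset.sum_comm, Fintype.sum_prod_type]
  refine Finset.sum_congr rfl fun l _ => Fintype.sum_equiv (Equiv.mulLeft l⁻¹) _ _ fun h => ?_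
  simp only [Equiv.coe_mulLeft, mul_inv_cancel_left]

variable [Fintype K] [DecidableEq K]

/-- The restriction of functions to a subgroup, as a map of bialgebras. -/
noncomputable def restrict : FunHopf k H →ₐc[k] FunHopf k K :=
  BialgHom.ofAlgHom (restrictAlgHom K) rfl <| AlgHom.ext fun f => by
    change TensorProduct.map (restrictAlgHom K).toLinearMap (restrictAlgHom K).toLinearMap
      (Coalgebra.comul (R := k) f) = Coalgebra.comul (R := k) (restrictAlgHom K f)
    simp only [comul_eq_sum, map_sum, map_smul, TensorProduct.map_tmul, AlgHom.toLinearMap_apply]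
    symm
    refine Fintype.sum_of_injective (Prod.map Subtype.val Subtype.val)
      (Subtype.val_injective.prodMap Subtype.val_injective) _ _ (fun p hp => ?_) fun p => ?_
    · by_cases h₁ : p.1 ∈ K
      · have h₂ : p.2 ∉ K := fun h₂ => hp ⟨(⟨p.1, h₁⟩, ⟨p.2, h₂⟩), rfl⟩
        rw [restrictAlgHom_δ_of_notMem K h₂, TensorProduct.tmul_zero, smul_zero]
      · rw [restrictAlgHom_δ_of_notMem K h₁, TensorProduct.zero_tmul, smul_zero]
    · simp only [Prod.map_fst, Prod.map_snd, restrictAlgHom_δ]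
      rfl

theorem restrict_surjective : Function.Surjective (restrict K : FunHopf k H →ₐc[k] FunHopf k K) :=
  fun f => ⟨Function.extend Subtype.val (f : K → k) 0,
    funext (Function.Injective.extend_apply Subtype.val_injective f 0)⟩

theorem closure_support_eq_top {R : Type*} [Ring R] [Algebra k R] {ψ : FunHopf k H →ₐ[k] R}
    (hψ : InnerFaithful ψ) : Submonoid.closure {h | ψ (δ h) ≠ 0} = ⊤ := by
  classical
  rw [← Subgroup.closure_toSubmonoid_of_finite]
  set K := Subgroup.closure {h | ψ (δ h) ≠ 0}
  have hker (f : FunHopf k H) (hf : restrict K f = 0) : ψ f = 0 := by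
    rw [eq_sum f, map_sum]
    refine Finset.sum_eq_zero fun h _ => ?_
    by_cases hh : h ∈ K
    · have : f h = 0 := congrFun hf ⟨h, hh⟩
      rw [this, zero_smul, map_zero]
    · rw [map_smul, not_not.1 fun h0 => hh (Subgroup.subset_closure h0), smul_zero]
  have hinj := hψ.injective_of_ker_le (restrict_surjective K) hker
  refine eq_top_iff.2 fun h _ => by_contra fun hh => ?_
  have h0 : (δ h : FunHopf k H) = 0 :=
    hinj ((restrictAlgHom_δ_of_notMem K hh).trans (map_zero _).symm)
  exact one_ne_zero (α := k) ((if_pos rfl).symm.trans (congrFun h0 h))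

end FunHopf

/-- The data `(u, c)` of a morphism `x # δ_h ↦ c(x, h) (u(x) # δ_h)` of bialgebras: the identities
say that it is unital, counital, multiplicative and comultiplicative. -/
structure BismashData.Hom {k X Y H : Type*} [Field k] [Group X] [Group Y] [Group H]
    (D : BismashData k X H) (E : BismashData k Y H) where
  u : X →* Y
  c : X → H → kˣ
  u_act : ∀ l x, u (D.act l x) = E.act l (u x)
  c_one : ∀ h, c 1 h = 1
  c_eval_one : ∀ x, c x 1 = 1
  c_mul : ∀ x y h, D.σ x y h * c (x * y) h = c x h * c y h * E.σ (u x) (u y) h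
  c_act : ∀ l x h, D.τ l x h * (c x l⁻¹ * c (D.act l x) (l * h)) = c x h * E.τ l (u x) h

namespace BismashData.Hom

variable {k X Y H : Type*} [Field k] [Group X] [Group Y] [Group H]
  {D : BismashData k X H} {E : BismashData k Y H} (F : D.Hom E)

/-- The linear map `x # δ_h ↦ c(x, h) (u(x) # δ_h)`. -/
noncomputable def toLinearMap : Bismash D →ₗ[k] Bismash E :=
  Bismash.lift fun x h => (F.c x h : k) • Bismash.b (F.u x) h

theorem toLinearMap_b (x : X) (h : H) :
    F.toLinearMap (Bismash.b x h) = (F.c x h : k) • Bismash.b (F.u x) h :=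
  Bismash.lift_b _ _ _

variable [Fintype H] [DecidableEq H]

theorem toLinearMap_one : F.toLinearMap 1 = 1 := by
  rw [Bismash.one_eq_sum, Bismash.one_eq_sum, map_sum]
  refine Finset.sum_congr rfl fun h _ => ?_
  rw [toLinearMap_b, F.c_one, Units.val_one, one_smul, map_one]

theorem toLinearMap_mul (a b : Bismash D) :
    F.toLinearMap (a * b) = F.toLinearMap a * F.toLinearMap b := by
  suffices (LinearMap.mul k (Bismash D)).compr₂ F.toLinearMap =
      (LinearMap.mul k (Bismash E)).compl₁₂ F.toLinearMap F.toLinearMap from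
    congrArg (fun G => G a b) this
  refine Bismash.hom_ext fun x h => Bismash.hom_ext fun y g => ?_
  simp only [LinearMap.compr₂_apply, LinearMap.compl₁₂_apply, LinearMap.mul_apply', toLinearMap_b,
    smul_mul_smul_comm, Bismash.b_mul_b]
  split_ifs with hh
  · subst hh
    simp only [map_smul, toLinearMap_b, smul_smul, ← Units.val_mul, F.c_mul, map_mul]
  · rw [map_zero, smul_zero]

/-- The map of bialgebras `x # δ_h ↦ c(x, h) (u(x) # δ_h)`. -/
noncomputable def toBialgHom : Bismash D →ₐc[k] Bismash E :=
  BialgHom.ofAlgHom (AlgHom.ofLinearMap F.toLinearMap F.toLinearMap_one F.toLinearMap_mul)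
    (AlgHom.toLinearMap_injective <| Bismash.hom_ext fun x h => by
      change Coalgebra.counit (R := k) (F.toLinearMap (Bismash.b x h)) =
        Coalgebra.counit (R := k) (Bismash.b x h)
      rw [toLinearMap_b, map_smul, Bismash.counit_b, Bismash.counit_b]
      split_ifs with hh
      · rw [hh, F.c_eval_one, Units.val_one, one_smul]
      · rw [smul_zero])
    (AlgHom.toLinearMap_injective <| Bismash.hom_ext fun x h => by
      change TensorProduct.map F.toLinearMap F.toLinearMap
        (Coalgebra.comul (R := k) (Bismash.b x h)) =
          Coalgebra.comul (R := k) (F.toLinearMap (Bismash.b x h))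
      simp only [toLinearMap_b, map_smul, Bismash.comul_b, map_sum, TensorProduct.map_tmul,
        TensorProduct.smul_tmul_smul, Finset.smul_sum, smul_smul, ← Units.val_mul, F.c_act,
        F.u_act])

theorem toBialgHom_b (x : X) (h : H) :
    F.toBialgHom (Bismash.b x h) = (F.c x h : k) • Bismash.b (F.u x) h :=
  F.toLinearMap_b x h

end BismashData.Hom

namespace QuotientDatum

variable {k Γ H : Type*} [Field k] [Group Γ] [Group H] [MulDistribMulAction H Γ]

section Proj

variable (D : QuotientDatum k Γ H) (j : NormalizedSection D.N)

theorem mul_section_inv_mem (r : Γ) : r * (j r)⁻¹ ∈ D.N := by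
  rw [← QuotientGroup.eq_one_iff, QuotientGroup.mk_mul, QuotientGroup.mk_inv, j.mk_toFun,
    mul_inv_cancel]

/-- The scalar `Φ(r j(u(r))⁻¹)(h)` by which the projection `k[Γ] ⋊ k^H → k[Γ/N] ⋊_Φ k^H` takes
`r # δ_h` to a multiple of `u(r) # δ_h`, where `u : Γ → Γ/N` is the quotient map. -/
def projCoeff (r : Γ) (h : H) : kˣ := D.φ h (r * (j r)⁻¹) (D.mul_section_inv_mem j r)

theorem projCoeff_section (x : Γ ⧸ D.N) (h : H) : D.projCoeff j (j x) h = 1 := by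
  rw [projCoeff, D.φ_congr _ (m := 1), φ_one]
  rw [j.mk_toFun, mul_inv_cancel]

theorem projCoeff_one (h : H) : D.projCoeff j 1 h = 1 :=
  j.map_one ▸ D.projCoeff_section j 1 h

theorem projCoeff_of_mem {n : Γ} (hn : n ∈ D.N) (h : H) : D.projCoeff j n h = D.φ h n hn :=
  D.φ_congr _ <| by rw [(QuotientGroup.eq_one_iff n).2 hn, ← QuotientGroup.mk_one, j.map_one,
    inv_one, mul_one]

theorem projCoeff_mul (r s : Γ) (h : H) : D.projCoeff j (r * s) h =
    D.projCoeff j r h * D.projCoeff j s h * (D.bismashData j).σ r s h := by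
  change D.φ _ _ _ = D.φ _ _ _ * D.φ _ _ _ * D.φ _ _ _
  rw [D.φ_conj (D.mul_section_inv_mem j s) (j r), φ_mul_φ, φ_mul_φ]
  apply φ_congr
  rw [QuotientGroup.mk_mul]
  group

theorem projCoeff_mul_τ (l : H) (r : Γ) (h : H) :
    D.projCoeff j r h * (D.bismashData j).τ l r h =
      D.projCoeff j r l⁻¹ * D.projCoeff j (l • r) (l * h) := by
  change D.φ _ _ _ * D.φ _ _ _ = D.φ _ _ _ * D.φ _ _ _
  rw [D.φ_eq_smul l (D.mul_section_inv_mem j r), mul_right_comm, φ_mul_φ, mul_comm]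
  congr 1
  apply φ_congr
  rw [smul_mul', smul_inv', D.act_mk]
  group

/-- The morphism `r # δ_h ↦ Φ(r j(u(r))⁻¹)(h) (u(r) # δ_h)` from the structure maps of
`k[Γ] ⋊ k^H` to those of `k[Γ/N] ⋊_Φ k^H`. -/
def projHom : (smashData k Γ H).Hom (D.bismashData j) where
  u := QuotientGroup.mk' D.N
  c := D.projCoeff j
  u_act _ _ := rfl
  c_one := D.projCoeff_one j
  c_eval_one _ := D.φ_eval_one _
  c_mul r s h := (one_mul _).trans (D.projCoeff_mul j r s h)
  c_act l r h := (one_mul _).trans (D.projCoeff_mul_τ j l r h).symm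

variable [Fintype H] [DecidableEq H]

/-- The canonical projection `k[Γ] ⋊ k^H → k[Γ/N] ⋊_Φ k^H`. -/
noncomputable def proj : SmashCoproduct k Γ H →ₐc[k] D.TwistedSmash j := (D.projHom j).toBialgHom

theorem proj_b (r : Γ) (h : H) : D.proj j (Bismash.b r h) =
    (D.projCoeff j r h : k) • Bismash.b (r : Γ ⧸ D.N) h :=
  (D.projHom j).toBialgHom_b r h

/-- The linear section `x # δ_h ↦ j(x) # δ_h` of the projection. -/
noncomputable def sectionMap : D.TwistedSmash j →ₗ[k] SmashCoproduct k Γ H :=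
  Bismash.lift fun x h => Bismash.b (j x) h

theorem sectionMap_b (x : Γ ⧸ D.N) (h : H) :
    D.sectionMap j (Bismash.b x h) = Bismash.b (j x) h :=
  Bismash.lift_b _ _ _

theorem proj_b_section (x : Γ ⧸ D.N) (h : H) :
    D.proj j (Bismash.b (j x) h) = Bismash.b x h := by
  rw [proj_b, projCoeff_section, Units.val_one, one_smul, j.mk_toFun]

theorem proj_sectionMap (z : D.TwistedSmash j) : D.proj j (D.sectionMap j z) = z := by
  suffices (D.proj j : SmashCoproduct k Γ H →ₗ[k] D.TwistedSmash j) ∘ₗ D.sectionMap j =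
      LinearMap.id from congrArg (fun G => G z) this
  refine Bismash.hom_ext fun x h => ?_
  exact (congrArg (D.proj j) (D.sectionMap_b j x h)).trans (D.proj_b_section j x h)

theorem proj_surjective : Function.Surjective (D.proj j) :=
  Function.RightInverse.surjective (D.proj_sectionMap j)

end Proj

end QuotientDatum

theorem FunHopf.one_apply {k H : Type*} [Field k] (h : H) : (1 : FunHopf k H) h = 1 := rfl

namespace SmashCoproduct

variable {k Γ H : Type*} [Field k] [Group Γ] [Group H] [MulDistribMulAction H Γ]
  [Fintype H] [DecidableEq H]

theorem elt_mul_b (r s : Γ) (f : FunHopf k H) (h : H) :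
    (elt r f * Bismash.b s h : SmashCoproduct k Γ H) = f h • Bismash.b (r * s) h := by
  simp only [elt, Finset.sum_mul, smul_mul_assoc, b_mul_b, smul_ite, smul_zero,
    Finset.sum_ite_eq', Finset.mem_univ, if_true]

theorem incl_δ (h : H) : incl k Γ H (FunHopf.δ h) = Bismash.b 1 h := by
  change elt 1 (FunHopf.δ h) = _
  simp only [elt, FunHopf.δ_apply, ite_smul, one_smul, zero_smul, Finset.sum_ite_eq,
    Finset.mem_univ, if_true]

variable {R : Type*} [Ring R] [Algebra k R] (ψ : SmashCoproduct k Γ H →ₐ[k] R)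

theorem map_elt_mul_map_b (r s : Γ) (f : FunHopf k H) (h : H) :
    ψ (elt r f) * ψ (Bismash.b s h) = f h • ψ (Bismash.b (r * s) h) := by
  rw [← map_mul, elt_mul_b, map_smul]

theorem map_elt_one_eq_iff (r : Γ) (f : FunHopf k H) :
    ψ (elt r 1) = ψ (elt 1 f) ↔ ∀ h, ψ (Bismash.b r h) = f h • ψ (Bismash.b 1 h) := by
  refine ⟨fun e h => ?_, fun e => ?_⟩
  · calc ψ (Bismash.b r h) = ψ (elt r 1) * ψ (Bismash.b 1 h) := by
          rw [map_elt_mul_map_b, mul_one, FunHopf.one_apply, one_smul]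
      _ = f h • ψ (Bismash.b 1 h) := by rw [e, map_elt_mul_map_b, one_mul]
  · simp only [elt, map_sum, map_smul, FunHopf.one_apply, one_smul, e]

end SmashCoproduct

section Representation

open SmashCoproduct

variable {k Γ H R : Type*} [Field k] [Group Γ] [Group H] [MulDistribMulAction H Γ]
  [Fintype H] [DecidableEq H] [Ring R] [Algebra k R] {ψ : SmashCoproduct k Γ H →ₐ[k] R}

theorem smul_mem_imageSubgroup (l : H) {r : Γ} (hr : r ∈ imageSubgroup ψ) :
    l • r ∈ imageSubgroup ψ := fun h => by
  simpa only [mul_smul] using hr (h * l)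

theorem imageSubgroup_normal (ψ : SmashCoproduct k Γ H →ₐ[k] R) : (imageSubgroup ψ).Normal := by
  refine ⟨fun r hr s h => ?_⟩
  obtain ⟨f, hf⟩ := hr h
  refine ⟨f, ?_⟩
  -- The element `1 # f` commutes with `s # 1`.
  calc ψ (elt (h • (s * r * s⁻¹)) 1)
      = ψ (elt (h • s) 1) * ψ (elt (h • r) 1) * ψ (elt (h • s)⁻¹ 1) := by
        simp only [← map_mul, elt_mul_elt, mul_one, smul_mul', smul_inv']
    _ = ψ (elt 1 (f : FunHopf k H)) := by
        simp only [hf, ← map_mul, elt_mul_elt, mul_one, one_mul, mul_inv_cancel]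

theorem imageSubgroup_le_comp {S : Type*} [Ring S] [Algebra k S] (φ : R →ₐ[k] S) :
    imageSubgroup ψ ≤ imageSubgroup (φ.comp ψ) := fun _ hr h =>
  (hr h).imp fun _ hf => congrArg φ hf

theorem exists_map_b_eq_smul_of_mem {r : Γ} (hr : r ∈ imageSubgroup ψ) :
    ∃ f : FunHopf k H, ∀ h, ψ (Bismash.b r h) = f h • ψ (Bismash.b 1 h) := by
  obtain ⟨f, hf⟩ := hr 1
  rw [one_smul, map_elt_one_eq_iff] at hf
  exact ⟨f, hf⟩

theorem mem_compatibleData_iff {D : QuotientDatum k Γ H} :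
    D ∈ compatibleData ψ ↔ ∀ n (hn : n ∈ D.N) h,
      ψ (Bismash.b n h) = (D.φ h n hn : k) • ψ (Bismash.b 1 h) := by
  simp only [compatibleData, Set.mem_ofPred_eq, map_elt_one_eq_iff, Subtype.forall]
  rfl

theorem map_b_mul_left {D : QuotientDatum k Γ H} (hD : D ∈ compatibleData ψ) {n : Γ}
    (hn : n ∈ D.N) (r : Γ) (h : H) :
    ψ (Bismash.b (n * r) h) = (D.φ h n hn : k) • ψ (Bismash.b r h) := by
  calc ψ (Bismash.b (n * r) h) = ψ (elt n 1) * ψ (Bismash.b r h) := by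
        rw [map_elt_mul_map_b, FunHopf.one_apply, one_smul]
    _ = (D.Φ ⟨n, hn⟩ : FunHopf k H) h • ψ (Bismash.b r h) := by
        rw [hD ⟨n, hn⟩, map_elt_mul_map_b, one_mul]

end Representation

namespace QuotientDatum

variable {k Γ H : Type*} [Field k] [Group Γ] [Group H] [MulDistribMulAction H Γ]
  (D : QuotientDatum k Γ H)

/-- The restriction of the quotient datum `(N, Φ)` to a smaller subgroup. -/
def restrict (N' : Subgroup Γ) (hN' : N'.Normal) (stable : ∀ (h : H), ∀ r ∈ N', h • r ∈ N')
    (hle : N' ≤ D.N) : QuotientDatum k Γ H where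
  N := N'
  normal := hN'
  stable := stable
  Φ := D.Φ.comp (Subgroup.inclusion hle)
  Φ_mul r := D.Φ_mul ⟨r, hle r.2⟩
  Φ_conj r := D.Φ_conj ⟨r, hle r.2⟩

variable [Fintype H] [DecidableEq H]

theorem restrict_mem_compatibleData {R : Type*} [Ring R] [Algebra k R]
    {ψ : SmashCoproduct k Γ H →ₐ[k] R} {D : QuotientDatum k Γ H} (hD : D ∈ compatibleData ψ)
    {N' : Subgroup Γ} (hN' : N'.Normal) (stable : ∀ (h : H), ∀ r ∈ N', h • r ∈ N')
    (hle : N' ≤ D.N) : D.restrict N' hN' stable hle ∈ compatibleData ψ :=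
  mem_compatibleData_iff.2 fun n hn => mem_compatibleData_iff.1 hD n (hle hn)

variable (j : NormalizedSection D.N)

theorem mem_compatibleData_proj : D ∈ compatibleData (D.proj j : _ →ₐ[k] D.TwistedSmash j) := by
  refine mem_compatibleData_iff.2 fun n hn h => ?_
  change D.proj j (Bismash.b n h) = (D.φ h n hn : k) • D.proj j (Bismash.b 1 h)
  have hn1 : (n : Γ ⧸ D.N) = ((1 : Γ) : Γ ⧸ D.N) := (QuotientGroup.eq_one_iff n).2 hn
  rw [proj_b, proj_b, D.projCoeff_of_mem j hn, hn1, projCoeff_one, Units.val_one, one_smul]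

variable {D} {R : Type*} [Ring R] [Algebra k R] {ψ : SmashCoproduct k Γ H →ₐ[k] R}

theorem map_sectionMap_proj (hD : D ∈ compatibleData ψ) (a : SmashCoproduct k Γ H) :
    ψ (D.sectionMap j (D.proj j a)) = ψ a := by
  suffices (ψ : SmashCoproduct k Γ H →ₗ[k] R) ∘ₗ D.sectionMap j ∘ₗ
      (D.proj j : SmashCoproduct k Γ H →ₗ[k] D.TwistedSmash j) = ψ from
    congrArg (fun G => G a) this
  refine Bismash.hom_ext fun r h => ?_
  change ψ (D.sectionMap j (D.proj j (Bismash.b r h))) = ψ (Bismash.b r h)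
  rw [proj_b, map_smul, map_smul, sectionMap_b]
  simpa only [projCoeff, inv_mul_cancel_right] using
    (map_b_mul_left hD (D.mul_section_inv_mem j r) (j r) h).symm

theorem map_eq_zero_of_proj_eq_zero (hD : D ∈ compatibleData ψ) {a : SmashCoproduct k Γ H}
    (ha : D.proj j a = 0) : ψ a = 0 := by
  rw [← map_sectionMap_proj j hD, ha, map_zero, map_zero]

end QuotientDatum

section BialgebraQuotient

open SmashCoproduct

variable {k Γ H L : Type*} [Field k] [Group Γ] [Group H] [MulDistribMulAction H Γ]
  [Fintype H] [DecidableEq H] [Ring L] [Bialgebra k L] {q : SmashCoproduct k Γ H →ₐc[k] L}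

theorem SmashCoproduct.one_tmul_b_mul_comul_b (r : Γ) (g h : H) :
    ((1 : SmashCoproduct k Γ H) ⊗ₜ[k] Bismash.b 1 h) *
        Coalgebra.comul (R := k) (Bismash.b r (g * h) : SmashCoproduct k Γ H) =
      Bismash.b r g ⊗ₜ[k] Bismash.b (g⁻¹ • r) h := by
  rw [comul_b, Finset.mul_sum, Finset.sum_eq_single g⁻¹ (fun l _ hl => ?_) (by simp)]
  · rw [Algebra.TensorProduct.tmul_mul_tmul, inv_inv, inv_mul_cancel_left, b_mul_b, if_pos rfl,
      one_mul, one_mul]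
  · rw [Algebra.TensorProduct.tmul_mul_tmul, b_mul_b, if_neg, TensorProduct.tmul_zero]
    exact fun e => hl (by rw [eq_inv_iff_mul_eq_one]; simpa [← mul_assoc] using e.symm)

variable (q) in
theorem one_tmul_map_b_mul_comul_map_b (r : Γ) (g h : H) :
    ((1 : L) ⊗ₜ[k] q (Bismash.b 1 h)) * Coalgebra.comul (R := k) (q (Bismash.b r (g * h))) =
      q (Bismash.b r g) ⊗ₜ[k] q (Bismash.b (g⁻¹ • r) h) := by
  let Q := Algebra.TensorProduct.map (q : SmashCoproduct k Γ H →ₐ[k] L)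
    (q : SmashCoproduct k Γ H →ₐ[k] L)
  have hQ (a) : Q (Coalgebra.comul (R := k) a) = Coalgebra.comul (R := k) (q a) :=
    CoalgHomClass.map_comp_comul_apply q a
  rw [← hQ, ← map_one q]
  exact (map_mul Q _ _).symm.trans (congrArg Q (one_tmul_b_mul_comul_b r g h))

theorem counit_map_b_one (r : Γ) : Coalgebra.counit (R := k) (q (Bismash.b r 1)) = 1 := by
  rw [CoalgHomClass.counit_comp_apply, Bismash.counit_b, if_pos rfl]

theorem map_b_mul_map_b (r s : Γ) (h : H) :
    q (Bismash.b r h) * q (Bismash.b s h) = q (Bismash.b (r * s) h) := by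
  rw [← map_mul, b_mul_b, if_pos rfl]

theorem map_b_ne_zero (hq : ∀ h, q (Bismash.b 1 h) ≠ 0) (r : Γ) (h : H) :
    q (Bismash.b r h) ≠ 0 := fun e =>
  hq h <| by rw [← mul_inv_cancel r, ← map_b_mul_map_b, e, zero_mul]

theorem map_b_tmul_map_b_of_eq_smul {r : Γ} {g h : H} {c : k}
    (hr : q (Bismash.b r (g * h)) = c • q (Bismash.b 1 (g * h))) :
    q (Bismash.b r g) ⊗ₜ[k] q (Bismash.b (g⁻¹ • r) h) =
      c • (q (Bismash.b 1 g) ⊗ₜ[k] q (Bismash.b 1 h)) := by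
  rw [← one_tmul_map_b_mul_comul_map_b, hr, map_smul, mul_smul_comm,
    one_tmul_map_b_mul_comul_map_b, smul_one]

theorem exists_map_b_eq_smul (hq : ∀ h, q (Bismash.b 1 h) ≠ 0) {r : Γ}
    (hr : q (Bismash.b r 1) = q (Bismash.b 1 1)) (h : H) :
    ∃ c : k, q (Bismash.b r h) = c • q (Bismash.b 1 h) := by
  refine exists_eq_smul_of_tmul_eq_tmul (map_b_ne_zero hq (h⁻¹ • r) h⁻¹)
    ((map_b_tmul_map_b_of_eq_smul (c := 1) ?_).trans (one_smul k _))
  rw [mul_inv_cancel, hr, one_smul]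

theorem map_b_smul_one (hq : ∀ h, q (Bismash.b 1 h) ≠ 0) {r : Γ}
    (hr : q (Bismash.b r 1) = q (Bismash.b 1 1)) (l : H) :
    q (Bismash.b (l • r) 1) = q (Bismash.b 1 1) := by
  obtain ⟨c, hc⟩ := exists_map_b_eq_smul hq hr l⁻¹
  have e := map_b_tmul_map_b_of_eq_smul (g := l⁻¹) (h := 1) (by rw [mul_one, hc])
  rw [TensorProduct.smul_tmul', ← hc, inv_inv] at e
  exact tmul_right_injective (map_b_ne_zero hq r l⁻¹) e

theorem mem_imageSubgroup_iff (hq : ∀ h, q (Bismash.b 1 h) ≠ 0) {r : Γ} :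
    r ∈ imageSubgroup (q : SmashCoproduct k Γ H →ₐ[k] L) ↔
      q (Bismash.b r 1) = q (Bismash.b 1 1) := by
  refine ⟨fun hr => ?_, fun hr l => ?_⟩
  · obtain ⟨f, hf⟩ := exists_map_b_eq_smul_of_mem hr
    have hf1 : q (Bismash.b r 1) = f 1 • q (Bismash.b 1 1) := hf 1
    have hc := congrArg (Coalgebra.counit (R := k)) hf1
    rw [map_smul, counit_map_b_one, counit_map_b_one, smul_eq_mul, mul_one] at hc
    rw [hf1, ← hc, one_smul]
  · choose c hc using exists_map_b_eq_smul hq (map_b_smul_one hq hr l)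
    have hc0 (h : H) : c h ≠ 0 := fun e =>
      map_b_ne_zero hq (l • r) h (by rw [hc, e, zero_smul])
    exact ⟨⟨c, fun h => (c h)⁻¹, funext fun h => mul_inv_cancel₀ (hc0 h),
      funext fun h => inv_mul_cancel₀ (hc0 h)⟩, (map_elt_one_eq_iff _ _ _).2 hc⟩

theorem mul_inv_mem_imageSubgroup (hq : ∀ h, q (Bismash.b 1 h) ≠ 0) {r s : Γ} {l : H}
    (hrs : q (Bismash.b (l • r) 1) = q (Bismash.b (l • s) 1)) :
    r * s⁻¹ ∈ imageSubgroup (q : SmashCoproduct k Γ H →ₐ[k] L) := by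
  suffices l • (r * s⁻¹) ∈ imageSubgroup (q : SmashCoproduct k Γ H →ₐ[k] L) by
    simpa only [inv_smul_smul] using smul_mem_imageSubgroup l⁻¹ this
  rw [mem_imageSubgroup_iff hq, smul_mul', ← map_b_mul_map_b, hrs, map_b_mul_map_b, ← smul_mul',
    mul_inv_cancel, smul_one]

theorem linearIndependent_map_b {ι : Type*} {s : ι → Γ} (hq : ∀ h, q (Bismash.b 1 h) ≠ 0)
    (hs : Pairwise fun i j => s i * (s j)⁻¹ ∉ imageSubgroup (q : SmashCoproduct k Γ H →ₐ[k] L)) :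
    LinearIndependent k fun p : ι × H => q (Bismash.b (s p.1) p.2) := by
  refine linearIndependent_of_map_eq_tmul (W := L) (fun p => map_b_ne_zero hq _ _) ?_
  rintro ⟨i, h⟩ ⟨j, g⟩ hne
  obtain rfl | hhg := eq_or_ne h g
  · refine ⟨LinearMap.mulLeft k (1 ⊗ₜ q (Bismash.b 1 1)) ∘ₗ Coalgebra.comul,
      fun p => q (Bismash.b (p.2⁻¹ • s p.1) 1), fun p => ?_, fun e => ?_⟩
    · exact (mul_one p.2 ▸ one_tmul_map_b_mul_comul_map_b q (s p.1) p.2 1 :)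
    · exact hs (fun hij : i = j => hne (hij ▸ rfl)) (mul_inv_mem_imageSubgroup hq e)
  · refine ⟨(TensorProduct.mk k L L).flip (q (Bismash.b 1 1)) ∘ₗ
        LinearMap.mulLeft k (q (Bismash.b 1 h)),
      fun p => if h = p.2 then q (Bismash.b 1 1) else 0, fun p => ?_, ?_⟩
    · change (q (Bismash.b 1 h) * q (Bismash.b (s p.1) p.2)) ⊗ₜ[k] q (Bismash.b 1 1) =
        q (Bismash.b (s p.1) p.2) ⊗ₜ[k] if h = p.2 then q (Bismash.b 1 1) else 0
      rw [← map_mul, b_mul_b, one_mul]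
      split_ifs with hp
      · rw [hp]
      · rw [map_zero, TensorProduct.zero_tmul, TensorProduct.tmul_zero]
    · simpa only [if_true, if_neg hhg] using hq 1

theorem QuotientDatum.proj_eq_zero_of_map_eq_zero (hq : ∀ h, q (Bismash.b 1 h) ≠ 0)
    {D : QuotientDatum k Γ H} (hD : D ∈ compatibleData (q : SmashCoproduct k Γ H →ₐ[k] L))
    (hN : imageSubgroup (q : SmashCoproduct k Γ H →ₐ[k] L) ≤ D.N) (j : NormalizedSection D.N)
    {a : SmashCoproduct k Γ H} (ha : q a = 0) : D.proj j a = 0 := by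
  have hj : Pairwise fun x y => j x * (j y)⁻¹ ∉
      imageSubgroup (q : SmashCoproduct k Γ H →ₐ[k] L) := fun x y hxy hmem => hxy <| by
    rw [← j.mk_toFun x, ← j.mk_toFun y, ← mul_inv_eq_one]
    exact (QuotientGroup.eq_one_iff _).2 (hN hmem)
  have hinj : Function.Injective ((q : SmashCoproduct k Γ H →ₗ[k] L) ∘ₗ D.sectionMap j) := by
    have hlift : (q : SmashCoproduct k Γ H →ₗ[k] L) ∘ₗ D.sectionMap j =
        Bismash.lift fun x h => q (Bismash.b (j x) h) := Bismash.hom_ext fun x h => by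
      rw [Bismash.lift_b]
      exact congrArg q (D.sectionMap_b j x h)
    rw [hlift]
    exact Bismash.basis.injective_constr_of_linearIndependent (linearIndependent_map_b hq hj)
  refine hinj ?_
  rw [map_zero]
  exact (map_sectionMap_proj j hD a).trans ha

variable {R : Type*} [Ring R] [Algebra k R] {φ : L →ₐ[k] R}

theorem map_b_one_left_ne_zero
    (hφ : InnerFaithful ((φ.comp (q : SmashCoproduct k Γ H →ₐ[k] L)).comp (incl k Γ H))) (h : H) :
    q (Bismash.b 1 h) ≠ 0 := by
  induction h using Submonoid.dense_induction _ (FunHopf.closure_support_eq_top hφ) with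
  | mem h hh =>
    intro e
    refine hh ?_
    rw [AlgHom.comp_apply, incl_δ]
    exact (congrArg φ e).trans (map_zero φ)
  | one =>
    intro e
    have hc := counit_map_b_one (q := q) (1 : Γ)
    rw [e, map_zero] at hc
    exact zero_ne_one hc
  | mul g h hg hh =>
    intro e
    refine tmul_ne_zero (k := k) hg hh ?_
    have hcut := one_tmul_map_b_mul_comul_map_b q 1 g h
    rwa [e, map_zero, mul_zero, smul_one, eq_comm] at hcut

theorem map_b_eq_φ_smul
    (hφ : InnerFaithful ((φ.comp (q : SmashCoproduct k Γ H →ₐ[k] L)).comp (incl k Γ H)))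
    {D : QuotientDatum k Γ H}
    (hD : D ∈ compatibleData (φ.comp (q : SmashCoproduct k Γ H →ₐ[k] L)))
    (hle : imageSubgroup (q : SmashCoproduct k Γ H →ₐ[k] L) ≤ D.N) {n : Γ}
    (hn : n ∈ imageSubgroup (q : SmashCoproduct k Γ H →ₐ[k] L)) (h : H) :
    q (Bismash.b n h) = (D.φ h n (hle hn) : k) • q (Bismash.b 1 h) := by
  have hq := map_b_one_left_ne_zero hφ
  induction h using Submonoid.dense_induction _ (FunHopf.closure_support_eq_top hφ)
    generalizing n with
  | mem h hh =>
    obtain ⟨f, hf⟩ := exists_map_b_eq_smul_of_mem hn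
    have hfh : q (Bismash.b n h) = f h • q (Bismash.b 1 h) := hf h
    rw [Set.mem_ofPred_eq, AlgHom.comp_apply, incl_δ] at hh
    have hfφ : f h • φ (q (Bismash.b 1 h)) = (D.φ h n (hle hn) : k) • φ (q (Bismash.b 1 h)) := by
      rw [← map_smul, ← hfh]
      exact mem_compatibleData_iff.1 hD n (hle hn) h
    rw [hfh, smul_left_injective k hh hfφ]
  | one => rw [D.φ_eval_one, Units.val_one, one_smul, (mem_imageSubgroup_iff hq).1 hn]
  | mul l h hl hh =>
    obtain ⟨f, hf⟩ := exists_map_b_eq_smul_of_mem hn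
    have hflh : q (Bismash.b n (l * h)) = f (l * h) • q (Bismash.b 1 (l * h)) := hf (l * h)
    have hcut := map_b_tmul_map_b_of_eq_smul hflh
    rw [hl hn, hh (smul_mem_imageSubgroup l⁻¹ hn), TensorProduct.smul_tmul_smul, ← Units.val_mul,
      mul_comm, ← D.φ_smul (hle hn)] at hcut
    rw [hflh, smul_left_injective k (tmul_ne_zero (hq l) (hq h)) hcut]

end BialgebraQuotient

theorem corollary4p3 {k Γ H R : Type*}
    [Field k] [Group Γ] [Group H] [Fintype H] [DecidableEq H] [MulDistribMulAction H Γ]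
    [Ring R] [Algebra k R] (ρ : SmashCoproduct k Γ H →ₐ[k] R)
    (hρ : InnerFaithful (ρ.comp (SmashCoproduct.incl k Γ H))) :
    (imageSubgroup ρ).Normal ∧
    (∀ (h : H), ∀ r ∈ imageSubgroup ρ, h • r ∈ imageSubgroup ρ) ∧
    ∀ D ∈ compatibleData ρ, D.N = imageSubgroup ρ → ∀ j : NormalizedSection D.N,
      ∃ (p : SmashCoproduct k Γ H →ₐc[k] D.TwistedSmash j) (ρ' : D.TwistedSmash j →ₐ[k] R),
        IsHopfImage.{w} ρ p ρ' := by
  refine ⟨imageSubgroup_normal ρ, fun h _ => smul_mem_imageSubgroup h, fun D hD hN j => ?_⟩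
  obtain ⟨ρ', hρ'⟩ := exists_isHopfFactorization (D.proj_surjective j)
    fun _ => QuotientDatum.map_eq_zero_of_proj_eq_zero j hD
  refine ⟨D.proj j, ρ', hρ'.isHopfImage_of_ker_le fun L _ _ q φ hφ a ha => ?_⟩
  obtain rfl := hφ.comp_eq
  have hle : imageSubgroup (q : SmashCoproduct k Γ H →ₐ[k] L) ≤ D.N :=
    hN ▸ imageSubgroup_le_comp φ
  let D' := D.restrict _ (imageSubgroup_normal _) (fun h _ => smul_mem_imageSubgroup h) hle
  have hD' : D' ∈ compatibleData (q : SmashCoproduct k Γ H →ₐ[k] L) :=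
    mem_compatibleData_iff.2 fun _ => map_b_eq_φ_smul hρ hD hle
  obtain ⟨j'⟩ : Nonempty (NormalizedSection D'.N) := inferInstance
  have ha' : D'.proj j' a = 0 :=
    QuotientDatum.proj_eq_zero_of_map_eq_zero (map_b_one_left_ne_zero hρ) hD' le_rfl j' ha
  exact QuotientDatum.map_eq_zero_of_proj_eq_zero j'
    (QuotientDatum.restrict_mem_compatibleData (D.mem_compatibleData_proj j) _ _ hle) ha'
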